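/- Let $A$ be a unital $C^*$-algebra and let $H$ be a (left) Hilbert $A$-module, with $A$-valued inner product $\langle\cdot,\cdot\rangle$ that is $A$-linear in the first variable. Suppose that $H$ is finitely or countably generated, i.e. some finite or countable subset of $H$ has norm-dense $A$-linear span. Let $K\in L(H)$, i.e. $K:H\to H$ is a map for which there is a map $K^*:H\to H$ with $\langle Kx,y\rangle=\langle x,K^*y\rangle$ for all $x,y\in H$. For $J\subseteq\mathbb N$ write $\ell^2(A)$ for the set of families $\{a_n\}_{n\in J}$ in $A$ for which $\sum_{n\in J}a_na_n^*$ converges in norm. Then there exist $J\subseteq\mathbb N$ and a standard Parseval frame $\{x_n\}_{n\in J}$ of $H$, i.e. a family in $H$ such that for every $x\in H$ the series $\sum_{n\in J}\langle x,x_n\rangle\langle x_n,x\rangle$ converges in norm to $\langle x,x\rangle$, such that $f_n:=Kx_n$ $(n\in J)$ is an atomic system for $K$; that is: 1. the series $\sum_{n\in J}c_nf_n$ converges in $H$ for every $\{c_n\}_{n\in J}\in\ell^2(A)$; 2. there is a constant $C>0$ such that for every $x\in H$ there is $\{a_{n,x}\}_{n\in J}\in\ell^2(A)$ with $\sum_{n\in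 J}a_{n,x}a_{n,x}^*\le C\langle x,x\rangle$ and $Kx=\sum_{n\in J}a_{n,x}f_n$. In particular, every $K\in L(H)$ has an atomic system. (All series converge unconditionally, in norm.) -/

import Mathlib

/-!
Hilbert `A`-modules are Mathlib's `CStarModule A H`: a left `A`-module with an `A`-valued inner
product that is `A`-linear in the *second* variable, `inner A y (a • x) = a * inner A y x`.
The inner product `⟨x, y⟩` that is `A`-linear in the first variable is therefore `inner A y x`
throughout.
-/

section HilbertModuleFrames

variable (A : Type*) {H : Type*} [CStarAlgebra A] [PartialOrder A]
  [NormedAddCommGroup H] [NormedSpace ℂ H] [Module A H] [CStarModule A H]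

/-- `H` is finitely or countably generated: some finite or countably infinite subset has a
norm-dense linear span. (As `A` is unital, the `A`-span contains the complex span.) -/
def IsCountablyGeneratedHilbertModule (A : Type*) (H : Type*) [CStarAlgebra A]
    [NormedAddCommGroup H] [Module A H] : Prop :=
  ∃ S : Set H, S.Countable ∧ Dense (Submodule.span A S : Set H)

/-- A map `K : H → H` (with no linearity or continuity assumed) is adjointable if there is a map
`K'` with `⟨K x, y⟩ = ⟨x, K' y⟩` for all `x, y`. -/
def IsAdjointableMap (K : H → H) : Prop :=
  ∃ K' : H → H, ∀ x y : H, inner A y (K x) = inner A (K' y) x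

/-- Membership in `ℓ²(A)`: the series `∑ aₙ aₙ*` converges in norm. (Its terms are positive, so
convergence of the ordered partial sums and of the net of finite sums mean the same.) -/
def MemEllTwo {A : Type*} [CStarAlgebra A] {J : Set ℕ} (a : J → A) : Prop :=
  Summable fun n => a n * star (a n)

/-- `{fₙ}` is a standard frame with bounds `C, D > 0`: for every `x` the series
`∑ ⟨x, fₙ⟩⟨fₙ, x⟩` converges in norm and lies between `C ⟨x, x⟩` and `D ⟨x, x⟩`. -/
def IsStandardFrameWithBounds {J : Set ℕ} (f : J → H) (C D : ℝ) : Prop :=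
  0 < C ∧ 0 < D ∧ ∀ x : H, ∃ s : A,
    HasSum (fun n => inner A (f n) x * inner A x (f n)) s ∧
      C • inner A x x ≤ s ∧ s ≤ D • inner A x x

/-- A standard Parseval (normalized tight) frame: a standard frame with both bounds `1`. -/
def IsStandardParsevalFrame {J : Set ℕ} (f : J → H) : Prop :=
  IsStandardFrameWithBounds A f 1 1

/-- `{fₙ}` is an atomic system for `K`: every series `∑ cₙ fₙ` with `c ∈ ℓ²(A)` converges, and
for one constant `C > 0` every `x` has coefficients `a ∈ ℓ²(A)` with `∑ aₙ aₙ* ≤ C ⟨x, x⟩` and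
`K x = ∑ aₙ fₙ`. Convergence is norm convergence of the net of finite partial sums. -/
def IsAtomicSystem {J : Set ℕ} (f : J → H) (K : H → H) : Prop :=
  (∀ c : J → A, MemEllTwo c → Summable fun n => c n • f n) ∧
    ∃ C : ℝ, 0 < C ∧ ∀ x : H, ∃ a : J → A, MemEllTwo a ∧
      ∑' n, a n * star (a n) ≤ C • inner A x x ∧ HasSum (fun n => a n • f n) (K x)

end HilbertModuleFrames

/-!
Inner products `⟨x, y⟩` in comments are linear in the first variable, so `⟨x, y⟩ = inner A y x`.

The heart of the matter is that a countably generated Hilbert module `H` has a Parseval frame.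
Rescale a generating sequence to `h` with `∑ ‖hₙ‖² ≤ 1`. Its frame operator `T x = ∑ ⟨x, hₙ⟩ hₙ`
satisfies `0 ≤ T ≤ 1` (`exists_frameOperator`). Put `R₀ = 1` and `Rₖ₊₁ = Rₖ - Rₖ T Rₖ`
(`frameResidual`). Then `0 ≤ Rₖ ≤ 1`, and `∑_{j < k} Rⱼ T Rⱼ = 1 - Rₖ`. The operators `Rⱼ T Rⱼ`
decrease, so `(k + 1) Rₖ T Rₖ ≤ 1`; as `T` dominates the rank-one operators of the `hₙ`, this forces
`‖Rₖ hₙ‖² ≤ 1 / (k + 1)`, and `Rₖ → 0` pointwise on `H` by density. Hence `∑ₖ Rₖ T Rₖ = 1` pointwise,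
which says that the vectors `Rₖ hₙ` form a Parseval frame
(`IsCountablyGeneratedHilbertModule.exists_parseval`). Only polynomials in `T` occur, so neither a
functional calculus for adjointable operators nor the stabilization theorem is needed.

For a Parseval frame `f`, the Cauchy–Schwarz inequality over finite index sets makes `∑ cₙ fₙ`
converge for every `c ∈ ℓ²(A)` (`summable_smul_of_bessel`), and `x = ∑ ⟨x, fₙ⟩ fₙ`
(`hasSum_inner_smul_of_parseval`). An adjointable map is `A`-linear and continuous by the closed
graph theorem, so it carries both facts over to `K fₙ` (`IsAdjointableMap.isAtomicSystem`), with
coefficients `⟨x, fₙ⟩` and constant `1`.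
-/

/-! ### Positive endomorphisms of a Hilbert module -/

section PositiveEndomorphisms

variable {A H : Type*} [CStarAlgebra A] [PartialOrder A]
  [NormedAddCommGroup H] [NormedSpace ℂ H] [Module A H] [CStarModule A H]

/-- A module endomorphism `P` is positive if it is symmetric and `⟨P x, x⟩ ≥ 0` for every `x`.
The inequality `P ≤ Q` between symmetric endomorphisms is expressed as positivity of `Q - P`. -/
structure IsPositiveEnd (P : Module.End A H) : Prop where
  symm : ∀ x y : H, inner A (P x) y = inner A x (P y)
  nonneg : ∀ x : H, 0 ≤ inner A x (P x)

namespace IsPositiveEnd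

theorem one : IsPositiveEnd (1 : Module.End A H) :=
  ⟨fun _ _ => rfl, fun _ => CStarModule.inner_self_nonneg⟩

theorem add [StarOrderedRing A] {P Q : Module.End A H} (hP : IsPositiveEnd P)
    (hQ : IsPositiveEnd Q) : IsPositiveEnd (P + Q) :=
  ⟨fun x y => by simp [hP.symm, hQ.symm], fun x => by
    simpa using add_nonneg (hP.nonneg x) (hQ.nonneg x)⟩

theorem conj {P Q Q' : Module.End A H} (hP : IsPositiveEnd P)
    (hQ : ∀ x y : H, inner A (Q x) y = inner A x (Q' y)) : IsPositiveEnd (Q' * P * Q) := by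
  have hQ' (x y : H) : inner A (Q' x) y = inner A x (Q y) := by
    rw [← CStarModule.star_inner, ← hQ, CStarModule.star_inner]
  refine ⟨fun x y => ?_, fun x => ?_⟩
  · simp [hQ', hP.symm, hQ]
  · simpa [← hQ] using hP.nonneg (Q x)

variable [StarOrderedRing A]

/-- If `0 ≤ P ≤ 1` then `P² ≤ P`, because `P - P² = P (1 - P) P + (1 - P) P (1 - P)`. -/
theorem sub_mul_self {P : Module.End A H} (hP : IsPositiveEnd P) (hP1 : IsPositiveEnd (1 - P)) :
    IsPositiveEnd (P - P * P) := by
  have h : P - P * P = P * (1 - P) * P + (1 - P) * P * (1 - P) := by noncomm_ring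
  rw [h]
  exact (hP1.conj hP.symm).add (hP.conj hP1.symm)

theorem inner_apply_le {P : Module.End A H} (hP1 : IsPositiveEnd (1 - P)) (x : H) :
    inner A x (P x) ≤ inner A x x := by
  simpa using hP1.nonneg x

theorem inner_apply_apply_le {P : Module.End A H} (hP : IsPositiveEnd P)
    (hP1 : IsPositiveEnd (1 - P)) (x : H) : inner A (P x) (P x) ≤ inner A x (P x) := by
  have := (hP.sub_mul_self hP1).nonneg x
  rw [hP.symm]
  simpa using this

theorem norm_apply_sq_le {P : Module.End A H} (hP : IsPositiveEnd P)
    (hP1 : IsPositiveEnd (1 - P)) (x : H) : ‖P x‖ ^ 2 ≤ ‖inner A x (P x)‖ := by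
  rw [CStarModule.norm_sq_eq A]
  exact CStarAlgebra.norm_le_norm_of_nonneg_of_le CStarModule.inner_self_nonneg
    (hP.inner_apply_apply_le hP1 x)

theorem norm_apply_le {P : Module.End A H} (hP : IsPositiveEnd P)
    (hP1 : IsPositiveEnd (1 - P)) (x : H) : ‖P x‖ ≤ ‖x‖ := by
  refine le_of_sq_le_sq ?_ (norm_nonneg x)
  rw [CStarModule.norm_sq_eq A (x := x)]
  exact (hP.norm_apply_sq_le hP1 x).trans
    (CStarAlgebra.norm_le_norm_of_nonneg_of_le (hP.nonneg x) (hP1.inner_apply_le x))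

end IsPositiveEnd

end PositiveEndomorphisms

/-! ### Exhausting the identity operator -/

section Residual

variable {A H : Type*} [CStarAlgebra A] [NormedAddCommGroup H] [Module A H]

/-- The residuals `R₀ = 1`, `Rₖ₊₁ = Rₖ - Rₖ T Rₖ` left after subtracting from the identity the
positive operators `Rₖ T Rₖ` one after the other. On scalars `t ∈ (0, 1]` the recursion
`r ↦ r (1 - t r)` decreases to `0`. -/
def frameResidual (T : Module.End A H) : ℕ → Module.End A H
  | 0 => 1
  | k + 1 => frameResidual T k - frameResidual T k * T * frameResidual T k

/-- The defining recursion of the residuals telescopes. -/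
theorem sum_frameResidual_conj (T : Module.End A H) (k : ℕ) :
    ∑ j ∈ Finset.range k, frameResidual T j * T * frameResidual T j = 1 - frameResidual T k := by
  induction k with
  | zero => simp [frameResidual]
  | succ k ih => rw [Finset.sum_range_succ, ih, frameResidual]; abel

variable [PartialOrder A] [StarOrderedRing A] [NormedSpace ℂ H] [CStarModule A H]
  {T : Module.End A H}

theorem frameResidual_isPositiveEnd (hT : IsPositiveEnd T) (hT1 : IsPositiveEnd (1 - T)) (k : ℕ) :
    IsPositiveEnd (frameResidual T k) ∧ IsPositiveEnd (1 - frameResidual T k) := by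
  induction k with
  | zero =>
    refine ⟨.one, ?_⟩
    simpa [frameResidual] using ⟨fun x y => by simp, fun x => by simp⟩
  | succ k ih =>
    obtain ⟨h, h1⟩ := ih
    constructor
    · have e : frameResidual T (k + 1) =
          (frameResidual T k - frameResidual T k * frameResidual T k) +
          frameResidual T k * (1 - T) * frameResidual T k := by
        rw [frameResidual]; noncomm_ring
      rw [e]
      exact (h.sub_mul_self h1).add (hT1.conj h.symm)
    · have e : 1 - frameResidual T (k + 1) = (1 - frameResidual T k) +
          frameResidual T k * T * frameResidual T k := by
        rw [frameResidual]; noncomm_ring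
      rw [e]
      exact h1.add (hT.conj h.symm)

theorem antitone_inner_frameResidual_conj (hT : IsPositiveEnd T) (hT1 : IsPositiveEnd (1 - T)) (x : H) :
    Antitone fun k => inner A x ((frameResidual T k * T * frameResidual T k) x) := by
  refine antitone_nat_of_succ_le fun k => ?_
  have h := (frameResidual_isPositiveEnd hT hT1 k).1
  have h' := (frameResidual_isPositiveEnd hT hT1 (k + 1)).1
  have hadj (x y : H) :
      inner A ((T * frameResidual T k) x) y = inner A x ((frameResidual T k * T) y) := by
    simp [hT.symm, h.symm]
  -- With `R = Rₖ`, `R' = Rₖ₊₁ = R - R T R`: `R T R - R' T R' = R T (R + R') T R`.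
  have e : frameResidual T k * T * frameResidual T k -
        frameResidual T (k + 1) * T * frameResidual T (k + 1) =
      frameResidual T k * T * (frameResidual T k + frameResidual T (k + 1)) *
        (T * frameResidual T k) := by
    simp only [frameResidual]; noncomm_ring
  have := ((h.add h').conj hadj).nonneg x
  rw [← e] at this
  simpa only [LinearMap.sub_apply, CStarModule.inner_sub_right, sub_nonneg] using this

/-- The residuals satisfy `Rₖ T Rₖ ≤ 1 / (k + 1)`, since the operators `Rⱼ T Rⱼ` decrease and their
sum is at most `1`. -/
theorem norm_inner_frameResidual_conj_le (hT : IsPositiveEnd T) (hT1 : IsPositiveEnd (1 - T)) (k : ℕ)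
    (x : H) : (k + 1) * ‖inner A x ((frameResidual T k * T * frameResidual T k) x)‖ ≤ ‖x‖ ^ 2 := by
  have hpos := (hT.conj (frameResidual_isPositiveEnd hT hT1 k).1.symm).nonneg x
  have h1 : (k + 1) • inner A x ((frameResidual T k * T * frameResidual T k) x) ≤ inner A x x := by
    calc (k + 1) • inner A x ((frameResidual T k * T * frameResidual T k) x)
        ≤ ∑ j ∈ Finset.range (k + 1),
            inner A x ((frameResidual T j * T * frameResidual T j) x) := by
          simpa using Finset.card_nsmul_le_sum (Finset.range (k + 1)) _
            (inner A x ((frameResidual T k * T * frameResidual T k) x)) fun j hj =>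
              antitone_inner_frameResidual_conj hT hT1 x (Nat.lt_succ_iff.mp (Finset.mem_range.mp hj))
      _ = inner A x ((1 - frameResidual T (k + 1)) x) := by
          rw [← sum_frameResidual_conj, LinearMap.sum_apply, CStarModule.inner_sum_right]
      _ ≤ inner A x x := by
          simpa using (frameResidual_isPositiveEnd hT hT1 (k + 1)).1.nonneg x
  have h2 := CStarAlgebra.norm_le_norm_of_nonneg_of_le (nsmul_nonneg hpos (k + 1)) h1
  rw [← CStarModule.norm_sq_eq A, ← Nat.cast_smul_eq_nsmul ℝ, norm_smul] at h2
  simpa [abs_of_nonneg (by positivity : (0 : ℝ) ≤ k + 1)] using h2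

/-- If the rank-one operator `x ↦ ⟨x, g⟩ g` is dominated by `T`, then the residuals of `T` tend to
zero at `g`. -/
theorem tendsto_frameResidual_of_le (hT : IsPositiveEnd T) (hT1 : IsPositiveEnd (1 - T)) {g : H}
    (hg : ∀ x : H, inner A g x * inner A x g ≤ inner A x (T x)) :
    Filter.Tendsto (fun k => frameResidual T k g) Filter.atTop (nhds 0) := by
  have key (k : ℕ) : ‖frameResidual T k g‖ ^ 2 ≤ 1 / ((k : ℝ) + 1) := by
    set R := frameResidual T k with hR
    have hRpos := (frameResidual_isPositiveEnd hT hT1 k).1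
    rw [← hR] at hRpos
    have h1 := norm_inner_frameResidual_conj_le hT hT1 k (R g)
    -- The bound `Rₖ T Rₖ ≤ 1 / (k + 1)` is tested on the vector `Rₖ g` itself.
    have h2 : (‖R g‖ ^ 2) ^ 2 ≤ ‖inner A (R g) ((R * T * R) (R g))‖ := by
      have h3 := hg (R (R g))
      rw [← hRpos.symm g, hRpos.symm (R g) g, hRpos.symm (R g) (T _)] at h3
      rw [CStarModule.norm_sq_eq A, sq, ← CStarRing.norm_self_mul_star, CStarModule.star_inner]
      refine CStarAlgebra.norm_le_norm_of_nonneg_of_le ?_ h3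
      simpa using mul_star_self_nonneg (inner A (R g) (R g))
    rw [le_div_iff₀ (by positivity)]
    rcases eq_or_ne (‖R g‖ ^ 2) 0 with h0 | h0
    · rw [h0]; simp
    · have hp : 0 < ‖R g‖ ^ 2 := lt_of_le_of_ne (by positivity) h0.symm
      nlinarith [mul_le_mul_of_nonneg_left h2 (by positivity : (0 : ℝ) ≤ k + 1)]
  rw [tendsto_zero_iff_norm_tendsto_zero]
  have h := squeeze_zero (fun k => by positivity) key tendsto_one_div_add_atTop_nhds_zero_nat
  simpa using h.sqrt

theorem tendsto_frameResidual_of_dense (hT : IsPositiveEnd T) (hT1 : IsPositiveEnd (1 - T))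
    [ContinuousConstSMul A H] {S : Set H}
    (hS : Dense (Submodule.span A S : Set H))
    (hg : ∀ g ∈ S, ∀ x : H, inner A g x * inner A x g ≤ inner A x (T x)) (x : H) :
    Filter.Tendsto (fun k => frameResidual T k x) Filter.atTop (nhds 0) := by
  have hspan : ∀ y ∈ Submodule.span A S,
      Filter.Tendsto (fun k => frameResidual T k y) Filter.atTop (nhds 0) := by
    intro y hy
    induction hy using Submodule.span_induction with
    | mem g h => exact tendsto_frameResidual_of_le hT hT1 (hg g h)
    | zero => simp
    | add y z _ _ hy hz => simpa using hy.add hz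
    | smul a y _ hy => simpa using hy.const_smul a
  rw [Metric.tendsto_atTop]
  intro ε hε
  obtain ⟨y, hy, hxy⟩ := hS.exists_dist_lt x (half_pos hε)
  obtain ⟨N, hN⟩ := Metric.tendsto_atTop.mp (hspan y hy) (ε / 2) (half_pos hε)
  refine ⟨N, fun k hk => ?_⟩
  obtain ⟨hR, hR1⟩ := frameResidual_isPositiveEnd hT hT1 k
  have h1 := hN k hk
  have h2 := hR.norm_apply_le hR1 (x - y)
  rw [dist_zero_right] at h1 ⊢
  rw [dist_eq_norm] at hxy
  have h3 : frameResidual T k x = frameResidual T k (x - y) + frameResidual T k y := by simp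
  rw [h3]
  linarith [norm_add_le (frameResidual T k (x - y)) (frameResidual T k y)]

end Residual

/-! ### The frame operator of a square-summable sequence -/

section FrameOperator

variable {A H : Type*} [CStarAlgebra A] [PartialOrder A]
  [NormedAddCommGroup H] [NormedSpace ℂ H] [Module A H] [CStarModule A H]

variable (A H) in
theorem CStarModule.isBoundedSMul : IsBoundedSMul A H := by
  refine IsBoundedSMul.of_norm_smul_le fun a x => ?_
  refine le_of_sq_le_sq ?_ (by positivity)
  rw [mul_pow, CStarModule.norm_sq_eq A, CStarModule.norm_sq_eq A (x := x),
    CStarModule.inner_op_smul_left,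
    CStarModule.inner_op_smul_right]
  calc _ ≤ ‖a‖ * ‖inner A x x‖ * ‖star a‖ := by
        refine (norm_mul_le _ _).trans ?_
        gcongr
        exact norm_mul_le _ _
    _ = _ := by rw [norm_star]; ring

variable [StarOrderedRing A]

theorem CStarModule.inner_mul_inner_swap_nonneg (x y : H) : 0 ≤ inner A x y * inner A y x := by
  rw [← CStarModule.star_inner x y]
  exact mul_star_self_nonneg _

/-- The frame operator `T x = ∑ ⟨x, hₙ⟩ hₙ` of a sequence with `∑ ‖hₙ‖² ≤ 1` in a complete module
exists and satisfies `0 ≤ T ≤ 1`, the upper bound by the Cauchy–Schwarz inequality. -/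
theorem exists_frameOperator [CompleteSpace H] (h : ℕ → H) (hs : Summable fun n => ‖h n‖ ^ 2)
    (hle : ∑' n, ‖h n‖ ^ 2 ≤ 1) :
    ∃ T : Module.End A H, IsPositiveEnd T ∧ IsPositiveEnd (1 - T) ∧
      ∀ x : H, HasSum (fun n => inner A (h n) x * inner A x (h n)) (inner A x (T x)) := by
  have := CStarModule.isBoundedSMul A H
  have hsum (x : H) : Summable fun n => inner A (h n) x • h n := by
    refine Summable.of_norm_bounded (hs.mul_right ‖x‖) fun n => ?_
    calc _ ≤ ‖inner A (h n) x‖ * ‖h n‖ := norm_smul_le _ _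
      _ ≤ ‖h n‖ * ‖x‖ * ‖h n‖ := by gcongr; exact CStarModule.norm_inner_le H
      _ = _ := by ring
  let T : Module.End A H :=
    { toFun := fun x => ∑' n, inner A (h n) x • h n
      map_add' := fun x y => by
        simp only [CStarModule.inner_add_right, add_smul]
        exact (hsum x).tsum_add (hsum y)
      map_smul' := fun a x => by
        simp only [CStarModule.inner_op_smul_right, mul_smul, RingHom.id_apply]
        exact (hsum x).tsum_const_smul a }
  have hT (x y : H) :
      HasSum (fun n => inner A (h n) x * inner A y (h n)) (inner A y (T x)) := by
    have := (hsum x).hasSum.mapL (CStarModule.innerSL (A := A) y)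
    simp only [CStarModule.innerSL_apply, CStarModule.inner_op_smul_right] at this
    exact this
  have hsymm (x y : H) : inner A (T x) y = inner A x (T y) := by
    refine HasSum.unique (f := fun n => inner A (h n) y * inner A x (h n)) ?_ (hT y x)
    have := (hT x y).star
    simpa only [star_mul, CStarModule.star_inner] using this
  refine ⟨T, ⟨hsymm, fun x => (hT x x).nonneg fun n => CStarModule.inner_mul_inner_swap_nonneg _ _⟩,
    ⟨fun x y => by simp [hsymm], fun x => ?_⟩, fun x => hT x x⟩
  simp only [LinearMap.sub_apply, Module.End.one_apply, CStarModule.inner_sub_right, sub_nonneg]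
  have h1 : inner A x (T x) ≤ (∑' n, ‖h n‖ ^ 2) • inner A x x :=
    hasSum_le (fun n => CStarModule.inner_mul_inner_swap_le) (hT x x)
      (hs.hasSum.smul_const (inner A x x))
  refine h1.trans ?_
  simpa using smul_le_smul_of_nonneg_right hle (CStarModule.inner_self_nonneg (A := A) (x := x))

end FrameOperator

/-! ### Sums of nonnegative elements and the Cauchy–Schwarz inequality -/

/-- A doubly indexed family of nonnegative elements of a C⋆-algebra has sum `s` as soon as its rows
are summable and the ordered partial sums of the row sums tend to `s`. -/
theorem CStarAlgebra.hasSum_prod_of_nonneg {A : Type*} [CStarAlgebra A] [PartialOrder A]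
    [StarOrderedRing A] {p : ℕ × ℕ → A} (hp : ∀ i, 0 ≤ p i) {r : ℕ → A} {s : A}
    (hr : ∀ k, HasSum (fun n => p (k, n)) (r k))
    (hs : Filter.Tendsto (fun N => ∑ k ∈ Finset.range N, r k) Filter.atTop (nhds s)) :
    HasSum p s := by
  have hrow (k : ℕ) : HasSum (fun i : ℕ × ℕ => if i.1 = k then p i else 0) (r k) := by
    refine (Function.Injective.hasSum_iff (Prod.mk_right_injective k) ?_).mp ?_
    · rintro ⟨a, b⟩ hab
      refine if_neg fun h => hab ⟨b, ?_⟩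
      rw [← h]
    · simpa [Function.comp_def] using hr k
  have hN (N : ℕ) : HasSum (fun i : ℕ × ℕ => if i.1 < N then p i else 0)
      (∑ k ∈ Finset.range N, r k) := by
    have := hasSum_sum (s := Finset.range N) fun k _ => hrow k
    simpa using this
  have hmono : Monotone fun N => ∑ k ∈ Finset.range N, r k := by
    refine monotone_nat_of_le_succ fun N => ?_
    rw [Finset.sum_range_succ]
    exact le_add_of_nonneg_right ((hr N).nonneg fun n => hp _)
  have hle (F : Finset (ℕ × ℕ)) : ∑ i ∈ F, p i ≤ s := by
    obtain ⟨N, hFN⟩ : ∃ N, ∀ i ∈ F, i.1 < N :=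
      ⟨F.sup Prod.fst + 1, fun i hi => Nat.lt_succ_of_le (Finset.le_sup (f := Prod.fst) hi)⟩
    have h1 : ∑ i ∈ F, p i = ∑ i ∈ F, if i.1 < N then p i else 0 :=
      Finset.sum_congr rfl fun i hi => (if_pos (hFN i hi)).symm
    rw [h1]
    refine (sum_le_hasSum F (fun i _ => ?_) (hN N)).trans (hmono.ge_of_tendsto hs N)
    split_ifs
    exacts [hp i, le_rfl]
  rw [HasSum, SummationFilter.unconditional_filter, Metric.tendsto_atTop]
  intro ε hε
  obtain ⟨N, hN1⟩ := Metric.tendsto_atTop.mp hs (ε / 2) (half_pos hε)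
  have hN2 := hN N
  rw [HasSum, SummationFilter.unconditional_filter, Metric.tendsto_atTop] at hN2
  obtain ⟨G, hG⟩ := hN2 (ε / 2) (half_pos hε)
  refine ⟨G, fun F hF => ?_⟩
  have h1 := hN1 N le_rfl
  have h2 := hG F hF
  have h3 : ‖s - ∑ i ∈ F, p i‖ ≤ ‖s - ∑ i ∈ F, if i.1 < N then p i else 0‖ := by
    refine CStarAlgebra.norm_le_norm_of_nonneg_of_le (sub_nonneg.mpr (hle F)) ?_
    refine sub_le_sub_left (Finset.sum_le_sum fun i _ => ?_) s
    split_ifs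
    exacts [le_rfl, hp i]
  rw [dist_comm, dist_eq_norm]
  refine h3.trans_lt ?_
  rw [← dist_eq_norm, dist_comm]
  linarith [dist_triangle (∑ i ∈ F, if i.1 < N then p i else 0) (∑ k ∈ Finset.range N, r k) s]

open scoped WithCStarModule in
/-- The Cauchy–Schwarz inequality in the free Hilbert module over a finite index set. -/
theorem CStarAlgebra.norm_sum_mul_sq_le {A ι : Type*} [CStarAlgebra A] [PartialOrder A]
    [StarOrderedRing A] (F : Finset ι) (c d : ι → A) :
    ‖∑ i ∈ F, c i * d i‖ ^ 2 ≤
      ‖∑ i ∈ F, c i * star (c i)‖ * ‖∑ i ∈ F, star (d i) * d i‖ := by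
  let u : C⋆ᵐᵒᵈ(A, F → A) := (WithCStarModule.equiv A (F → A)).symm fun i => star (d i)
  let v : C⋆ᵐᵒᵈ(A, F → A) := (WithCStarModule.equiv A (F → A)).symm fun i => c i
  have h := CStarModule.norm_inner_le (A := A) (C⋆ᵐᵒᵈ(A, F → A)) (x := u) (y := v)
  have h1 : inner A u v = ∑ i ∈ F, c i * d i := by
    rw [WithCStarModule.pi_inner, ← Finset.sum_coe_sort F]
    simp [u, v, WithCStarModule.inner_def]
  have h2 : ‖u‖ ^ 2 = ‖∑ i ∈ F, star (d i) * d i‖ := by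
    rw [WithCStarModule.pi_norm_sq, ← Finset.sum_coe_sort F]
    simp [u, WithCStarModule.inner_def]
  have h3 : ‖v‖ ^ 2 = ‖∑ i ∈ F, c i * star (c i)‖ := by
    rw [WithCStarModule.pi_norm_sq, ← Finset.sum_coe_sort F]
    simp [v, WithCStarModule.inner_def]
  rw [← h1, ← h2, ← h3, mul_comm, ← mul_pow]
  gcongr

/-! ### Bessel sequences and Parseval frames -/

section ParsevalFrames

variable {A H ι : Type*} [CStarAlgebra A] [PartialOrder A] [StarOrderedRing A]
  [NormedAddCommGroup H] [NormedSpace ℂ H] [Module A H] [CStarModule A H] {f : ι → H}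

/-- The synthesis map of a family satisfying the Bessel inequality with bound `1` is contractive. -/
theorem norm_sum_smul_sq_le
    (hf : ∀ (x : H) (F : Finset ι), ∑ n ∈ F, inner A (f n) x * inner A x (f n) ≤ inner A x x)
    (c : ι → A) (F : Finset ι) :
    ‖∑ n ∈ F, c n • f n‖ ^ 2 ≤ ‖∑ n ∈ F, c n * star (c n)‖ := by
  set y := ∑ n ∈ F, c n • f n with hy
  have h1 : inner A y y = ∑ n ∈ F, c n * inner A y (f n) := by
    conv_lhs => rw [hy]
    rw [← hy, CStarModule.inner_sum_right]
    simp
  have h2 := CStarAlgebra.norm_sum_mul_sq_le F c fun n => inner A y (f n)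
  simp only [CStarModule.star_inner] at h2
  have h3 : ‖∑ n ∈ F, inner A (f n) y * inner A y (f n)‖ ≤ ‖y‖ ^ 2 := by
    rw [CStarModule.norm_sq_eq A]
    exact CStarAlgebra.norm_le_norm_of_nonneg_of_le
      (Finset.sum_nonneg fun n _ => CStarModule.inner_mul_inner_swap_nonneg _ _) (hf y F)
  rw [← h1, ← CStarModule.norm_sq_eq A] at h2
  rcases eq_or_ne (‖y‖ ^ 2) 0 with h0 | h0
  · rw [h0]; positivity
  · have hp : 0 < ‖y‖ ^ 2 := lt_of_le_of_ne (by positivity) h0.symm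
    have h4 := h2.trans (mul_le_mul_of_nonneg_left h3 (norm_nonneg _))
    rw [sq] at h4
    exact le_of_mul_le_mul_right h4 hp

theorem summable_smul_of_bessel [CompleteSpace H]
    (hf : ∀ (x : H) (F : Finset ι), ∑ n ∈ F, inner A (f n) x * inner A x (f n) ≤ inner A x x)
    {c : ι → A} (hc : Summable fun n => c n * star (c n)) : Summable fun n => c n • f n := by
  rw [summable_iff_vanishing_norm] at hc ⊢
  intro ε hε
  obtain ⟨s, hs⟩ := hc (ε ^ 2) (by positivity)
  exact ⟨s, fun t ht => lt_of_pow_lt_pow_left₀ 2 hε.le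
    ((norm_sum_smul_sq_le hf c t).trans_lt (hs t ht))⟩

/-- The reconstruction formula of a Parseval frame: the remainder operator
`x ↦ x - ∑ ⟨x, fₙ⟩ fₙ` of a finite partial sum lies between `0` and `1`, hence its squared norm at
`x` is controlled by the remainder of the series for `⟨x, x⟩`. -/
theorem hasSum_inner_smul_of_parseval
    (hf : ∀ x : H, HasSum (fun n => inner A (f n) x * inner A x (f n)) (inner A x x)) (x : H) :
    HasSum (fun n => inner A (f n) x • f n) x := by
  have hle (x : H) (F : Finset ι) : ∑ n ∈ F, inner A (f n) x * inner A x (f n) ≤ inner A x x :=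
    sum_le_hasSum F (fun n _ => CStarModule.inner_mul_inner_swap_nonneg _ _) (hf x)
  have key (F : Finset ι) : ‖x - ∑ n ∈ F, inner A (f n) x • f n‖ ^ 2 ≤
      ‖inner A x x - ∑ n ∈ F, inner A (f n) x * inner A x (f n)‖ := by
    let S : Module.End A H :=
      { toFun := fun x => ∑ n ∈ F, inner A (f n) x • f n
        map_add' := fun x y => by simp [add_smul, Finset.sum_add_distrib]
        map_smul' := fun a x => by simp [mul_smul, Finset.smul_sum] }
    have hSx (x y : H) : inner A y (S x) = ∑ n ∈ F, inner A (f n) x * inner A y (f n) := by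
      simp [S]
    have hS : IsPositiveEnd S := by
      refine ⟨fun x y => ?_, fun x => ?_⟩
      · rw [← CStarModule.star_inner, hSx, hSx, star_sum]
        simp
      · rw [hSx]
        exact Finset.sum_nonneg fun n _ => CStarModule.inner_mul_inner_swap_nonneg _ _
    have hS1 : IsPositiveEnd (1 - S) :=
      ⟨fun x y => by simp [hS.symm], fun x => by simpa [hSx] using hle x F⟩
    have := hS1.norm_apply_sq_le (by simpa using hS) x
    rw [LinearMap.sub_apply, Module.End.one_apply, CStarModule.inner_sub_right, hSx] at this
    exact this
  have h0 : Filter.Tendsto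
      (fun F : Finset ι => ‖inner A x x - ∑ n ∈ F, inner A (f n) x * inner A x (f n)‖)
      Filter.atTop (nhds 0) := by
    have := ((tendsto_const_nhds (x := inner A x x)).sub (hf x)).norm
    simpa using this
  have h1 := (squeeze_zero (fun F => by positivity) key h0).sqrt
  simp only [Real.sqrt_zero, Real.sqrt_sq (norm_nonneg _)] at h1
  rw [HasSum, SummationFilter.unconditional_filter, tendsto_iff_norm_sub_tendsto_zero]
  simpa only [norm_sub_rev x] using h1

end ParsevalFrames

/-! ### Countably generated modules -/

/-- A countably generated Hilbert module has a square-summable sequence, of total mass at most `1`,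
that generates it. -/
theorem IsCountablyGeneratedHilbertModule.exists_seq {A H : Type*} [CStarAlgebra A]
    [NormedAddCommGroup H] [NormedSpace ℂ H] [Module A H] [IsScalarTower ℂ A H]
    (hH : IsCountablyGeneratedHilbertModule A H) :
    ∃ h : ℕ → H, Summable (fun n => ‖h n‖ ^ 2) ∧ ∑' n, ‖h n‖ ^ 2 ≤ 1 ∧
      Dense (Submodule.span A (Set.range h) : Set H) := by
  obtain ⟨S, hS, hd⟩ := hH
  -- Adjoining `0` makes the generating set nonempty, hence the range of a sequence.
  obtain ⟨g, hg⟩ := (hS.insert 0).exists_eq_range (Set.insert_nonempty 0 S)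
  let r : ℕ → ℝ := fun n => (1 / 2 : ℝ) ^ (n + 1) / (1 + ‖g n‖)
  have hr (n : ℕ) : 0 < r n := by positivity
  let h : ℕ → H := fun n => (r n : ℂ) • g n
  have hh (n : ℕ) : h n = (r n : ℂ) • g n := rfl
  have hle (n : ℕ) : ‖h n‖ ^ 2 ≤ (1 / 2 : ℝ) ^ (n + 1) := by
    have h1 : ‖h n‖ ≤ (1 / 2 : ℝ) ^ (n + 1) := by
      rw [hh, norm_smul, Complex.norm_real, Real.norm_of_nonneg (hr n).le, div_mul_eq_mul_div,
        div_le_iff₀ (by positivity)]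
      gcongr
      linarith
    have h2 : (1 / 2 : ℝ) ^ (n + 1) ≤ 1 := pow_le_one₀ (by norm_num) (by norm_num)
    nlinarith [norm_nonneg (h n)]
  have hgeo : HasSum (fun n : ℕ => (1 / 2 : ℝ) ^ (n + 1)) 1 := by
    have h := hasSum_geometric_two.mul_right (1 / 2 : ℝ)
    rw [mul_one_div_cancel two_ne_zero] at h
    simpa only [pow_succ] using h
  have hs : Summable fun n => ‖h n‖ ^ 2 :=
    Summable.of_nonneg_of_le (fun n => by positivity) hle hgeo.summable
  refine ⟨h, hs, hasSum_le hle hs.hasSum hgeo, hd.mono ?_⟩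
  refine Submodule.span_le.mpr fun x hx => ?_
  obtain ⟨n, rfl⟩ : x ∈ Set.range g := hg ▸ Set.mem_insert_of_mem 0 hx
  have h1 : g n = (((r n)⁻¹ : ℂ) • (1 : A)) • h n := by
    rw [hh, smul_assoc, one_smul, smul_smul, inv_mul_cancel₀ (by exact_mod_cast (hr n).ne'),
      one_smul]
  rw [h1]
  exact Submodule.smul_mem _ _ (Submodule.subset_span ⟨n, rfl⟩)

section HilbertModule

variable {A H : Type*} [CStarAlgebra A] [PartialOrder A]
  [NormedAddCommGroup H] [NormedSpace ℂ H] [Module A H] [CStarModule A H]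

variable [StarOrderedRing A] [CompleteSpace H] in
/-- The vectors `Rₖ hₙ` form a Parseval frame: for fixed `k` their series is that of `Rₖ T Rₖ`, and
these operators sum to the identity. -/
theorem IsCountablyGeneratedHilbertModule.exists_parseval [IsScalarTower ℂ A H]
    (hH : IsCountablyGeneratedHilbertModule A H) :
    ∃ f : ℕ × ℕ → H,
      ∀ x : H, HasSum (fun n => inner A (f n) x * inner A x (f n)) (inner A x x) := by
  obtain ⟨h, hs, hle, hd⟩ := hH.exists_seq
  obtain ⟨T, hT, hT1, hsum⟩ := exists_frameOperator (A := A) h hs hle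
  have := CStarModule.isBoundedSMul A H
  refine ⟨fun i => frameResidual T i.1 (h i.2), fun x => ?_⟩
  refine CStarAlgebra.hasSum_prod_of_nonneg
    (r := fun k => inner A x ((frameResidual T k * T * frameResidual T k) x))
    (fun i => CStarModule.inner_mul_inner_swap_nonneg _ _) (fun k => ?_) ?_
  · have hR := (frameResidual_isPositiveEnd hT hT1 k).1
    simpa [hR.symm] using hsum (frameResidual T k x)
  · have h0 : Filter.Tendsto (fun k => frameResidual T k x) Filter.atTop (nhds 0) := by
      refine tendsto_frameResidual_of_dense hT hT1 hd ?_ x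
      rintro _ ⟨n, rfl⟩ y
      exact le_hasSum (hsum y) n fun m _ => CStarModule.inner_mul_inner_swap_nonneg _ _
    have h1 := ((CStarModule.innerSL (A := A) x).continuous.tendsto 0).comp h0
    have h2 := (tendsto_const_nhds (x := inner A x x)).sub h1
    rw [map_zero, sub_zero] at h2
    refine h2.congr fun N => ?_
    rw [← CStarModule.inner_sum_right, ← LinearMap.sum_apply, sum_frameResidual_conj]
    simp [CStarModule.innerSL_apply]

/-! ### Adjointable maps -/

theorem CStarModule.ext_inner_left {x y : H} (h : ∀ z : H, inner A z x = inner A z y) : x = y := by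
  rw [← sub_eq_zero, ← CStarModule.inner_self (A := A), CStarModule.inner_sub_right, h, sub_self]

variable [StarOrderedRing A] [CompleteSpace H]

/-- An adjointable map is additive, homogeneous and, by the closed graph theorem, continuous. -/
theorem IsAdjointableMap.exists_continuousLinearMap {K : H → H} (hK : IsAdjointableMap A K) :
    ∃ L : H →L[ℂ] H, (∀ x, L x = K x) ∧ ∀ (a : A) (x : H), L (a • x) = a • L x := by
  obtain ⟨K', hK'⟩ := hK
  let L : H →ₗ[ℂ] H :=
    { toFun := K
      map_add' := fun x y => CStarModule.ext_inner_left (A := A) fun z => by simp [hK']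
      map_smul' := fun a x => CStarModule.ext_inner_left (A := A) fun z => by simp [hK'] }
  have hL : Continuous L := by
    refine L.continuous_of_seq_closed_graph fun u x y hu hy => ?_
    refine CStarModule.ext_inner_left (A := A) fun z => ?_
    have h1 := ((CStarModule.innerSL (A := A) z).continuous.tendsto y).comp hy
    have h2 := ((CStarModule.innerSL (A := A) (K' z)).continuous.tendsto x).comp hu
    refine tendsto_nhds_unique h1 ?_
    change Filter.Tendsto _ _ (nhds (inner A z (K x)))
    rw [hK']
    refine h2.congr fun n => ?_
    exact (hK' (u n) z).symm
  refine ⟨⟨L, hL⟩, fun x => rfl, fun a x => ?_⟩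
  exact CStarModule.ext_inner_left (A := A) fun z => by
    change inner A z (K (a • x)) = inner A z (a • K x)
    simp [hK']

/-- An adjointable map sends a Parseval frame to an atomic system, with the coefficients of the
reconstruction formula. -/
theorem IsAdjointableMap.isAtomicSystem {K : H → H} (hK : IsAdjointableMap A K) {J : Set ℕ}
    {f : J → H}
    (hf : ∀ x : H, HasSum (fun n => inner A (f n) x * inner A x (f n)) (inner A x x)) :
    IsAtomicSystem A (fun n => K (f n)) K := by
  obtain ⟨L, hLK, hLA⟩ := hK.exists_continuousLinearMap
  refine ⟨fun c hc => ?_, 1, one_pos, fun x => ⟨fun n => inner A (f n) x, ?_, ?_, ?_⟩⟩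
  · have h1 := (summable_smul_of_bessel (A := A) (f := f) (fun x F =>
      sum_le_hasSum F (fun n _ => CStarModule.inner_mul_inner_swap_nonneg _ _) (hf x)) hc).mapL L
    simpa only [hLA, hLK] using h1
  · simpa only [MemEllTwo, CStarModule.star_inner] using (hf x).summable
  · simp only [CStarModule.star_inner, one_smul]
    exact (hf x).tsum_eq.le
  · have h1 := (hasSum_inner_smul_of_parseval (A := A) hf x).mapL L
    simpa only [hLA, hLK] using h1

end HilbertModule

theorem theorem2p3 (A H : Type*) [CStarAlgebra A] [PartialOrder A] [StarOrderedRing A]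
    [NormedAddCommGroup H] [NormedSpace ℂ H] [Module A H] [IsScalarTower ℂ A H]
    [CStarModule A H] [CompleteSpace H] (hH : IsCountablyGeneratedHilbertModule A H)
    (K : H → H) (hK : IsAdjointableMap A K) :
    ∃ (J : Set ℕ) (x : J → H), IsStandardParsevalFrame A x ∧
      IsAtomicSystem A (fun n => K (x n)) K := by
  obtain ⟨g, hg⟩ := hH.exists_parseval
  obtain ⟨e⟩ : Nonempty ((Set.univ : Set ℕ) ≃ ℕ × ℕ) :=
    ⟨(Equiv.Set.univ ℕ).trans Nat.pairEquiv.symm⟩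
  have hf (x : H) : HasSum (fun n => inner A (g (e n)) x * inner A x (g (e n))) (inner A x x) :=
    e.hasSum_iff.mpr (hg x)
  refine ⟨Set.univ, fun n => g (e n), ⟨one_pos, one_pos, fun x => ?_⟩, hK.isAtomicSystem hf⟩
  exact ⟨inner A x x, hf x, (one_smul ℝ _).le, (one_smul ℝ _).ge⟩
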